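/- Let $\Omega$ be a set of functions $\omega\colon\mathbb{R}_{\ge 0}\to\mathbb{Z}_{\ge 0}$ such that every $\omega\in\Omega$ is non-decreasing and such that, for all time points $0\le t_1<\dots<t_n$ ($n\ge 1$) and all non-negative integers $x_1\le\dots\le x_n$, there is some $\omega\in\Omega$ with $\omega(t_i)=x_i$ for all $i$. Write $X_t(\omega)=\omega(t)$. For a finite (possibly empty) set $u\subset\mathbb{R}_{\ge 0}$ of time points, let $\mathscr{X}_u$ be the set of non-decreasing tuples $x_u=(x_s)_{s\in u}$ of non-negative integers, and let $(X_u=x_u)=\{\omega\in\Omega:\omega(s)=x_s\ \text{for all } s\in u\}$, so that $(X_\emptyset=x_\emptyset)=\Omega$. Let $\mathcal{F}_u$ be the algebra of sets generated by the events $\{\omega\in\Omega:(\omega(s))_{s\in v}\in B\}$ with $B\subseteq\mathscr{X}_v$ and $v$ a finite subset of $u\cup[\max u,\infty)$ (of $\mathbb{R}_{\ge 0}$ if $u=\emptyset$). Put $$\mathcal{D}=\{(A,(X_u=x_u)) : u\subset\mathbb{R}_{\ge0}\text{ finite},\ x_u\in\mathscr{X}_u,\ A\in\mathcal{F}_u\}.$$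 A *full conditional probability* is a real-valued map $P(A\mid C)$, defined for all $A\subseteq\Omega$ and all non-empty $C\subseteq\Omega$, such that for all $A,B\subseteq\Omega$ and all non-empty $C,D\subseteq\Omega$: $P(A\mid C)\ge 0$; $P(A\mid C)=1$ if $C\subseteq A$; $P(A\cup B\mid C)=P(A\mid C)+P(B\mid C)$ if $A\cap B=\emptyset$; and $P(A\cap D\mid C)=P(A\mid D\cap C)\,P(D\mid C)$ if $D\cap C\ne\emptyset$. A *coherent conditional probability* on $\mathcal{D}$ is a real-valued map on $\mathcal{D}$ that can be extended to a full conditional probability. Below, a *history* $(t,u,x_u,x)$ consists of $t\in\mathbb{R}_{\ge 0}$, a finite (possibly empty) set $u$ of time points that all precede $t$, a tuple $x_u\in\mathscr{X}_u$, and a non-negative integer $x$ with $x\ge x_s$ for all $s\in u$. A *counting process* is a coherent conditional probability $P$ on $\mathcal{D}$ such that $P(X_0=0\mid\Omega)=1$ and, for every history $(t,u,x_u,x)$, $$\lim_{\Delta\to0^+}\frac{P(X_{t+\Delta}\ge x+2\mid X_u=x_u,X_t=x)}{\Delta}=0$$ and, if $t>0$, $$\lim_{\Delta\to0^+}\frac{P(X_{t}\ge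 x+2\mid X_u=x_u,X_{t-\Delta}=x)}{\Delta}=0.$$ A *Poisson process* is a counting process $P$ such that, for every history $(t,u,x_u,x)$, every $\Delta\in\mathbb{R}_{\ge0}$ and every integer $y\ge x$, 1. $P(X_{t+\Delta}=y\mid X_u=x_u,X_t=x)=P(X_{t+\Delta}=y\mid X_t=x)$; 2. $P(X_{t+\Delta}=y\mid X_t=x)=P(X_{t+\Delta}=y-x\mid X_t=0)$; 3. $P(X_{t+\Delta}=y\mid X_t=x)=P(X_{\Delta}=y\mid X_0=x)$. **Corollary.** Let $P$ be a Poisson process. Then there is a rate $\lambda\in\mathbb{R}_{\ge0}$ such that, for every history $(t,u,x_u,x)$, $$\lim_{\Delta\to0^+}\frac{P(X_{t+\Delta}=x+1\mid X_u=x_u,X_t=x)}{\Delta}=\lambda$$ and, if $t>0$, $$\lim_{\Delta\to0^+}\frac{P(X_t=x+1\mid X_u=x_u,X_{t-\Delta}=x)}{\Delta}=\lambda.$$ -/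

import Mathlib

open Filter Topology
open scoped NNReal

namespace CountingProcess

/-! Increasing (possibly empty) sequences `u` of time points are finite sets `u : Finset ℝ≥0`,
and a tuple of counts `x_u` is a function `u → ℕ`. -/

/-- The set `𝒳_u` of non-decreasing tuples of counts indexed by the time points in `u`. -/
def stateTuples (u : Finset ℝ≥0) : Set (u → ℕ) := {x | Monotone x}

/-- The requirements on the sample space: all paths are non-decreasing, and every non-decreasing
tuple of counts at finitely many (at least one) time points is attained by some path. -/
structure IsSampleSpace (Ω : Set (ℝ≥0 → ℕ)) : Prop where
  mono : ∀ ω ∈ Ω, ∀ t Δ : ℝ≥0, ω t ≤ ω (t + Δ)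
  exists_path : ∀ u : Finset ℝ≥0, u.Nonempty → ∀ x ∈ stateTuples u,
    ∃ ω ∈ Ω, ∀ t : u, ω t = x t

/-- A full conditional probability on a sample space `S`. Only the values `P A C` with `C`
non-empty are meaningful. -/
structure IsFullCondProb {S : Type*} (P : Set S → Set S → ℝ) : Prop where
  nonneg : ∀ A C : Set S, C.Nonempty → 0 ≤ P A C
  eq_one : ∀ A C : Set S, C.Nonempty → C ⊆ A → P A C = 1
  add : ∀ A B C : Set S, C.Nonempty → A ∩ B = ∅ → P (A ∪ B) C = P A C + P B C
  bayes : ∀ A C D : Set S, C.Nonempty → D.Nonempty → (D ∩ C).Nonempty →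
    P (A ∩ D) C = P A (D ∩ C) * P D C

/-- `P` is a coherent conditional probability on the domain `𝒟`: its restriction to `𝒟` can be
extended to a full conditional probability. Values of `P` outside `𝒟` play no role. -/
def IsCoherentOn {S : Type*} (𝒟 : Set (Set S × Set S)) (P : Set S → Set S → ℝ) : Prop :=
  ∃ Q : Set S → Set S → ℝ, IsFullCondProb Q ∧ ∀ p ∈ 𝒟, P p.1 p.2 = Q p.1 p.2

variable (Ω : Set (ℝ≥0 → ℕ))

/-- The finitary event `(X_v ∈ B)`. -/
def tupleIn (v : Finset ℝ≥0) (B : Set (v → ℕ)) : Set Ω :=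
  {ω | (fun t : v => ω.1 t) ∈ B}

/-- The event `(X_u = x_u)`; for `u = ∅` it is the whole sample space. -/
def tupleEq (u : Finset ℝ≥0) (xu : u → ℕ) : Set Ω := tupleIn Ω u {xu}

/-- The event `(X_t = x)`. -/
def countEq (t : ℝ≥0) (x : ℕ) : Set Ω := {ω | ω.1 t = x}

/-- The event `(X_t ≥ x)`. -/
def countGE (t : ℝ≥0) (x : ℕ) : Set Ω := {ω | x ≤ ω.1 t}

/-- The field (algebra of sets) `ℱ_u` generated by the events `(X_v ∈ B)` for which every time
point of `v` belongs to `u ∪ [max u, ∞)`, with no restriction on `v` if `u` is empty. -/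
def futureField (u : Finset ℝ≥0) : Set (Set Ω) :=
  MeasureTheory.generateSetAlgebra
    {A | ∃ (v : Finset ℝ≥0) (B : Set (v → ℕ)), B ⊆ stateTuples v ∧
      (∀ t ∈ v, t ∈ u ∨ ∀ s ∈ u, s ≤ t) ∧ A = tupleIn Ω v B}

/-- The domain of counting processes: all pairs `(A, (X_u = x_u))` with `A ∈ ℱ_u` and
`x_u ∈ 𝒳_u`. -/
def domainCP : Set (Set Ω × Set Ω) :=
  {p | ∃ (u : Finset ℝ≥0), ∃ xu ∈ stateTuples u,
    p.1 ∈ futureField Ω u ∧ p.2 = tupleEq Ω u xu}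

/-- `History t u xu x` says that all time points of `u` precede `t` and that `(x_u, x)` is a
non-decreasing tuple indexed by `u ∪ {t}`. -/
def History (t : ℝ≥0) (u : Finset ℝ≥0) (xu : u → ℕ) (x : ℕ) : Prop :=
  (∀ s ∈ u, s < t) ∧ xu ∈ stateTuples u ∧ ∀ s : u, xu s ≤ x

variable {Ω}

/-- Counting processes: coherent conditional probabilities on the domain above that start at `0`
and are orderly. (Truncation of `t - Δ` is harmless: it occurs only for `Δ > t > 0`.) -/
structure IsCountingProcess (P : Set Ω → Set Ω → ℝ) : Prop where
  coherent : IsCoherentOn (domainCP Ω) P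
  start : P (countEq Ω 0 0) Set.univ = 1
  orderly_right : ∀ (t : ℝ≥0) (u : Finset ℝ≥0) (xu : u → ℕ) (x : ℕ), History t u xu x →
    Tendsto (fun Δ : ℝ≥0 =>
      P (countGE Ω (t + Δ) (x + 2)) (tupleEq Ω u xu ∩ countEq Ω t x) / (Δ : ℝ))
      (𝓝[>] 0) (𝓝 0)
  orderly_left : ∀ (t : ℝ≥0) (u : Finset ℝ≥0) (xu : u → ℕ) (x : ℕ), History t u xu x → 0 < t →
    Tendsto (fun Δ : ℝ≥0 =>
      P (countGE Ω t (x + 2)) (tupleEq Ω u xu ∩ countEq Ω (t - Δ) x) / (Δ : ℝ))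
      (𝓝[>] 0) (𝓝 0)

/-- Poisson processes: Markovian, state-homogeneous and time-homogeneous counting processes. -/
structure IsPoissonProcess (P : Set Ω → Set Ω → ℝ) : Prop extends IsCountingProcess P where
  markov : ∀ (t Δ : ℝ≥0) (u : Finset ℝ≥0) (xu : u → ℕ) (x y : ℕ), History t u xu x → x ≤ y →
    P (countEq Ω (t + Δ) y) (tupleEq Ω u xu ∩ countEq Ω t x) =
      P (countEq Ω (t + Δ) y) (countEq Ω t x)
  state_homogeneous : ∀ (t Δ : ℝ≥0) (x y : ℕ), x ≤ y →
    P (countEq Ω (t + Δ) y) (countEq Ω t x) =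
      P (countEq Ω (t + Δ) (y - x)) (countEq Ω t 0)
  time_homogeneous : ∀ (t Δ : ℝ≥0) (x y : ℕ), x ≤ y →
    P (countEq Ω (t + Δ) y) (countEq Ω t x) = P (countEq Ω Δ y) (countEq Ω 0 x)

end CountingProcess

/-!
Write `p₀ Δ`, `p₁ Δ`, `q Δ` for the probabilities of `X_Δ = 0`, `X_Δ = 1`, `X_Δ ≥ 2` given
`X_0 = 0`; they are non-negative and sum to one. By the Markov property and the two homogeneity
properties, both difference quotients in the theorem equal `p₁ Δ / Δ` for small `Δ > 0`
(`IsPoissonProcess.transition_eq`), so everything comes down to the limit of `p₁ Δ / Δ`, where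
`p₁ = 1 - p₀ - q` and `q Δ = o(Δ)` by orderliness.

Paths are non-decreasing, so `X_{s+t} = 0` forces `X_s = 0`, and Bayes's rule gives
`p₀ (s + t) = p₀ s * p₀ t` (`IsPoissonProcess.prob_zero_add`). A multiplicative function on `ℝ≥0`
with values in `[0, 1]` that does not vanish on all of `(0, ∞)` is `Δ ↦ exp (-λ Δ)` for some
`λ ≥ 0` (`exists_eq_exp_neg_mul`), whence `(1 - p₀ Δ) / Δ → λ`.

It remains to exclude `p₀ = 0` on `(0, ∞)`. In that case the process has almost surely left its
current state after any positive time, so that it almost surely increases by at least two over any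
interval, once in each half: `p₁ (Δ + Δ) = 0` (`IsPoissonProcess.prob_one_add_self_eq_zero`). Hence
`q (Δ + Δ) = 1` for all `Δ > 0`, which contradicts `q Δ = o(Δ)`.

The laws of probability hold for an extension `Q` of `P`, while the Poisson properties are those of
`P`; the two agree on `domainCP Ω`, so each passage between them rests on membership there.
-/

namespace CountingProcess

/-! ### Multiplicative functions on the half-line -/

/-- The Cauchy functional equation for non-negative functions on the half-line. -/
theorem eq_mul_of_additive_of_nonneg {g : ℝ≥0 → ℝ} (hadd : ∀ s t, g (s + t) = g s + g t)
    (hnonneg : ∀ t, 0 ≤ g t) (t : ℝ≥0) : g t = g 1 * t := by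
  have hzero : g 0 = 0 := by
    have := hadd 0 0
    rw [add_zero] at this
    linarith
  have hnsmul : ∀ (n : ℕ) (s : ℝ≥0), g (n * s) = n * g s := by
    intro n s
    induction n with
    | zero => simp [hzero]
    | succ k ih => push_cast; rw [add_mul, one_mul, hadd, ih]; ring
  have hmono : ∀ s r : ℝ≥0, s ≤ r → g s ≤ g r := by
    intro s r h
    obtain ⟨d, rfl⟩ := exists_add_of_le h
    rw [hadd]
    linarith [hnonneg d]
  -- Comparing `n * t` with the neighbouring integers bounds `n * |g t - g 1 * t|` uniformly in `n`.
  have hbound : ∀ n : ℕ, n * |g t - g 1 * t| ≤ g 1 := by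
    intro n
    have hlo := hmono _ _ (Nat.floor_le (zero_le : 0 ≤ (n : ℝ≥0) * t))
    have hhi := hmono _ _ (Nat.lt_floor_add_one ((n : ℝ≥0) * t)).le
    have h1 : ((⌊(n : ℝ≥0) * t⌋₊ : ℝ≥0) : ℝ) ≤ n * t := by
      exact_mod_cast Nat.floor_le (zero_le : 0 ≤ (n : ℝ≥0) * t)
    have h2 : (n * t : ℝ) ≤ ⌊(n : ℝ≥0) * t⌋₊ + 1 := by
      exact_mod_cast (Nat.lt_floor_add_one ((n : ℝ≥0) * t)).le
    have hfloor := hnsmul ⌊(n : ℝ≥0) * t⌋₊ 1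
    rw [mul_one] at hfloor
    rw [NNReal.coe_natCast] at h1
    rw [hnsmul, hfloor] at hlo
    rw [hnsmul, hadd, hfloor] at hhi
    have h3 := mul_le_mul_of_nonneg_right h1 (hnonneg 1)
    have h4 := mul_le_mul_of_nonneg_right h2 (hnonneg 1)
    rw [← abs_of_nonneg (Nat.cast_nonneg n : (0 : ℝ) ≤ n), ← abs_mul, abs_le]
    constructor <;> linarith
  by_contra hne
  have hpos : 0 < |g t - g 1 * t| := abs_pos.mpr (sub_ne_zero.mpr hne)
  obtain ⟨n, hn⟩ := exists_nat_gt (g 1 / |g t - g 1 * t|)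
  rw [div_lt_iff₀ hpos] at hn
  linarith [hbound n]

/-- The conclusion can fail without `hft₀`: the indicator function of `{0}` is multiplicative. -/
theorem exists_eq_exp_neg_mul {f : ℝ≥0 → ℝ} (hmul : ∀ s t, f (s + t) = f s * f t)
    (hnonneg : ∀ t, 0 ≤ f t) (hle : ∀ t, f t ≤ 1) {t₀ : ℝ≥0} (ht₀ : 0 < t₀) (hft₀ : f t₀ ≠ 0) :
    ∃ rate : ℝ≥0, ∀ t : ℝ≥0, f t = Real.exp (-(rate * t)) := by
  have hzero : f 0 ≠ 0 := by
    intro h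
    apply hft₀
    rw [← zero_add t₀, hmul, h, zero_mul]
  have hmultiple : ∀ n : ℕ, f (n * t₀) ≠ 0 := by
    intro n
    induction n with
    | zero => simpa using hzero
    | succ k ih => push_cast; rw [add_mul, one_mul, hmul]; exact mul_ne_zero ih hft₀
  have hpos : ∀ t, 0 < f t := by
    intro t
    refine (hnonneg t).lt_of_ne' fun h => ?_
    obtain ⟨n, hn⟩ := exists_nat_ge (t / t₀)
    obtain ⟨d, hd⟩ := exists_add_of_le ((div_le_iff₀ ht₀).mp hn)
    exact hmultiple n (by rw [hd, hmul, h, zero_mul])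
  have hlog : ∀ t, 0 ≤ -Real.log (f t) := fun t =>
    neg_nonneg.mpr (Real.log_nonpos (hnonneg t) (hle t))
  have hlinear := eq_mul_of_additive_of_nonneg (g := fun t => -Real.log (f t))
    (fun s t => by
      simp only [hmul, Real.log_mul (hpos s).ne' (hpos t).ne']
      ring) hlog
  refine ⟨⟨-Real.log (f 1), hlog 1⟩, fun t => ?_⟩
  change f t = Real.exp (-(-Real.log (f 1) * t))
  rw [← hlinear t, neg_neg, Real.exp_log (hpos t)]

theorem tendsto_one_sub_exp_neg_mul_div (rate : ℝ) :
    Tendsto (fun Δ : ℝ≥0 => (1 - Real.exp (-(rate * Δ))) / (Δ : ℝ)) (𝓝[>] 0) (𝓝 rate) := by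
  have hderiv : HasDerivAt (fun r : ℝ => 1 - Real.exp (-(rate * r))) rate 0 := by
    have h := (((hasDerivAt_id (0 : ℝ)).const_mul rate).neg.exp).const_sub 1
    simpa using h
  have hcoe : Tendsto (fun Δ : ℝ≥0 => (Δ : ℝ)) (𝓝[>] 0) (𝓝[≠] 0) := by
    refine tendsto_nhdsWithin_iff.mpr ⟨?_, ?_⟩
    · exact (NNReal.continuous_coe.tendsto' 0 0 rfl).mono_left nhdsWithin_le_nhds
    · filter_upwards [self_mem_nhdsWithin] with Δ hΔ
      exact NNReal.coe_ne_zero.mpr (ne_of_gt hΔ)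
  refine ((hasDerivAt_iff_tendsto_slope.mp hderiv).comp hcoe).congr fun Δ => ?_
  simp [slope_def_field]

/-! ### Full conditional probabilities -/

namespace IsFullCondProb

variable {S : Type*} {Q : Set S → Set S → ℝ}

theorem mono (hQ : IsFullCondProb Q) {A B C : Set S} (hC : C.Nonempty) (hAB : A ⊆ B) :
    Q A C ≤ Q B C := by
  have h := hQ.add A (B \ A) C hC (Set.inter_sdiff_self A B)
  rw [Set.union_sdiff_cancel hAB] at h
  linarith [hQ.nonneg (B \ A) C hC]

theorem le_one (hQ : IsFullCondProb Q) {A C : Set S} (hC : C.Nonempty) : Q A C ≤ 1 :=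
  (hQ.mono hC (Set.subset_univ A)).trans_eq (hQ.eq_one _ _ hC (Set.subset_univ C))

/-- Conditioning on an event of probability one does not increase probabilities. -/
theorem le_univ_of_eq_one (hQ : IsFullCondProb Q) {A D : Set S} (hD : D.Nonempty)
    (h1 : Q D Set.univ = 1) :
    Q A D ≤ Q A Set.univ := by
  have huniv : (Set.univ : Set S).Nonempty := hD.mono (Set.subset_univ D)
  have h := hQ.bayes A Set.univ D huniv hD (by rwa [Set.inter_univ])
  rw [Set.inter_univ, h1, mul_one] at h
  rw [← h]
  exact hQ.mono huniv Set.inter_subset_left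

end IsFullCondProb

/-! ### Events of the sample space -/

variable {Ω : Set (ℝ≥0 → ℕ)}

theorem IsSampleSpace.le (hΩ : IsSampleSpace Ω) (ω : Ω) {s t : ℝ≥0} (h : s ≤ t) :
    ω.1 s ≤ ω.1 t := by
  obtain ⟨d, rfl⟩ := exists_add_of_le h
  exact hΩ.mono ω.1 ω.2 s d

theorem IsSampleSpace.countEq_nonempty (hΩ : IsSampleSpace Ω) (t : ℝ≥0) (x : ℕ) :
    (countEq Ω t x).Nonempty := by
  obtain ⟨ω, hω, h⟩ := hΩ.exists_path {t} (Finset.singleton_nonempty t) (fun _ => x)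
    (fun _ _ _ => le_rfl)
  exact ⟨⟨ω, hω⟩, h ⟨t, Finset.mem_singleton_self t⟩⟩

theorem tupleEq_empty (xu : (∅ : Finset ℝ≥0) → ℕ) : tupleEq Ω ∅ xu = Set.univ :=
  Set.eq_univ_of_forall fun _ => funext fun s => absurd s.2 (Finset.notMem_empty _)

theorem tupleEq_singleton (t : ℝ≥0) (x : ℕ) : tupleEq Ω {t} (fun _ => x) = countEq Ω t x := by
  ext ω
  constructor
  · exact fun h => congrFun h ⟨t, Finset.mem_singleton_self t⟩
  · intro h
    funext ⟨s, hs⟩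
    obtain rfl := Finset.mem_singleton.mp hs
    exact h

theorem mem_futureField {u : Finset ℝ≥0} {t : ℝ≥0} (hu : ∀ s ∈ u, s ≤ t) (B : Set ℕ) :
    {ω : Ω | ω.1 t ∈ B} ∈ futureField Ω u := by
  refine MeasureTheory.generateSetAlgebra.base _
    ⟨{t}, {x | x ⟨t, Finset.mem_singleton_self t⟩ ∈ B}, ?_, ?_, rfl⟩
  · rintro x - ⟨a, ha⟩ ⟨b, hb⟩ -
    obtain rfl := Finset.mem_singleton.mp ha
    obtain rfl := Finset.mem_singleton.mp hb
    exact le_rfl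
  · intro s hs
    obtain rfl := Finset.mem_singleton.mp hs
    exact Or.inr hu

theorem mem_domainCP_univ (t : ℝ≥0) (B : Set ℕ) :
    ({ω : Ω | ω.1 t ∈ B}, Set.univ) ∈ domainCP Ω :=
  ⟨∅, fun _ => 0, fun _ _ _ => le_rfl, mem_futureField (by simp) B, (tupleEq_empty _).symm⟩

theorem mem_domainCP_countEq {s t : ℝ≥0} (h : s ≤ t) (B : Set ℕ) (x : ℕ) :
    ({ω : Ω | ω.1 t ∈ B}, countEq Ω s x) ∈ domainCP Ω :=
  ⟨{s}, fun _ => x, fun _ _ _ => le_rfl, mem_futureField (by simpa using h) B,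
    (tupleEq_singleton s x).symm⟩

/-! ### Transition probabilities of a Poisson process -/

namespace IsPoissonProcess

variable {P Q : Set Ω → Set Ω → ℝ}

theorem homogeneous (hP : IsPoissonProcess P) (t Δ : ℝ≥0) {x y : ℕ} (hxy : x ≤ y) :
    P (countEq Ω (t + Δ) y) (countEq Ω t x) = P (countEq Ω Δ (y - x)) (countEq Ω 0 0) := by
  rw [hP.state_homogeneous t Δ x y hxy, hP.time_homogeneous t Δ 0 (y - x) (Nat.zero_le _)]

theorem transition_eq (hP : IsPoissonProcess P) {t : ℝ≥0} (Δ : ℝ≥0) {u : Finset ℝ≥0} {xu : u → ℕ}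
    {x : ℕ} (h : History t u xu x) :
    P (countEq Ω (t + Δ) (x + 1)) (tupleEq Ω u xu ∩ countEq Ω t x) =
      P (countEq Ω Δ 1) (countEq Ω 0 0) := by
  rw [hP.markov t Δ u xu x (x + 1) h x.le_succ, hP.homogeneous t Δ (Nat.le_add_right x 1),
    Nat.add_sub_cancel_left]

theorem tendsto_ge_two_div (hP : IsPoissonProcess P) :
    Tendsto (fun Δ : ℝ≥0 => P (countGE Ω Δ 2) (countEq Ω 0 0) / (Δ : ℝ)) (𝓝[>] 0) (𝓝 0) := by
  have h := hP.orderly_right 0 ∅ (fun _ => 0) 0 ⟨by simp, fun _ _ _ => le_rfl, fun _ => le_rfl⟩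
  simpa only [tupleEq_empty, Set.univ_inter, zero_add] using h

theorem prob_zero_add (hΩ : IsSampleSpace Ω) (hP : IsPoissonProcess P) (hQ : IsFullCondProb Q)
    (hPQ : ∀ p ∈ domainCP Ω, P p.1 p.2 = Q p.1 p.2) (s t : ℝ≥0) :
    P (countEq Ω (s + t) 0) (countEq Ω 0 0) =
      P (countEq Ω s 0) (countEq Ω 0 0) * P (countEq Ω t 0) (countEq Ω 0 0) := by
  have hst : P (countEq Ω t 0) (countEq Ω 0 0) = Q (countEq Ω (s + t) 0) (countEq Ω s 0) := by
    refine (hP.homogeneous s t (le_refl 0)).symm.trans ?_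
    exact hPQ _ (mem_domainCP_countEq le_self_add {0} 0)
  have h0 (r : ℝ≥0) : P (countEq Ω r 0) (countEq Ω 0 0) = Q (countEq Ω r 0) (countEq Ω 0 0) :=
    hPQ _ (mem_domainCP_countEq zero_le {0} 0)
  have hsub {r v : ℝ≥0} (hrv : r ≤ v) : countEq Ω v 0 ⊆ countEq Ω r 0 :=
    fun ω hω => Nat.le_zero.mp ((hΩ.le ω hrv).trans_eq hω)
  have hinter : countEq Ω s 0 ∩ countEq Ω 0 0 = countEq Ω s 0 :=
    Set.inter_eq_left.mpr (hsub zero_le)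
  have h := hQ.bayes (countEq Ω (s + t) 0) (countEq Ω 0 0) (countEq Ω s 0)
    (hΩ.countEq_nonempty _ _) (hΩ.countEq_nonempty _ _)
    (by rw [hinter]; exact hΩ.countEq_nonempty _ _)
  rw [hinter, Set.inter_eq_left.mpr (hsub le_self_add)] at h
  rw [hst, h0, h0, h, mul_comm]

theorem sum_eq_one (hΩ : IsSampleSpace Ω) (hQ : IsFullCondProb Q)
    (hPQ : ∀ p ∈ domainCP Ω, P p.1 p.2 = Q p.1 p.2) (Δ : ℝ≥0) :
    P (countEq Ω Δ 0) (countEq Ω 0 0) + P (countEq Ω Δ 1) (countEq Ω 0 0) +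
      P (countGE Ω Δ 2) (countEq Ω 0 0) = 1 := by
  have hne := hΩ.countEq_nonempty 0 0
  have h0 : P (countEq Ω Δ 0) (countEq Ω 0 0) = Q (countEq Ω Δ 0) (countEq Ω 0 0) :=
    hPQ _ (mem_domainCP_countEq zero_le {0} 0)
  have h1 : P (countEq Ω Δ 1) (countEq Ω 0 0) = Q (countEq Ω Δ 1) (countEq Ω 0 0) :=
    hPQ _ (mem_domainCP_countEq zero_le {1} 0)
  have h2 : P (countGE Ω Δ 2) (countEq Ω 0 0) = Q (countGE Ω Δ 2) (countEq Ω 0 0) :=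
    hPQ _ (mem_domainCP_countEq zero_le (Set.Ici 2) 0)
  rw [h0, h1, h2, ← hQ.add _ _ _ hne, ← hQ.add _ _ _ hne]
  · refine hQ.eq_one _ _ hne fun ω _ => ?_
    simp only [countEq, countGE, Set.mem_union, Set.mem_ofPred_eq]
    omega
  · refine Set.eq_empty_of_forall_notMem fun ω => ?_
    simp only [countEq, countGE, Set.mem_inter_iff, Set.mem_union, Set.mem_ofPred_eq]
    omega
  · refine Set.eq_empty_of_forall_notMem fun ω => ?_
    simp only [countEq, Set.mem_inter_iff, Set.mem_ofPred_eq]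
    omega

/-- If the process almost surely does not remain in its initial state for a time `Δ`, then it
almost surely does not go from `0` to `1` during a time `Δ + Δ`: otherwise it would have to rest in
one of the two halves. -/
theorem prob_one_add_self_eq_zero (hΩ : IsSampleSpace Ω) (hP : IsPoissonProcess P)
    (hQ : IsFullCondProb Q) (hPQ : ∀ p ∈ domainCP Ω, P p.1 p.2 = Q p.1 p.2) {Δ : ℝ≥0}
    (hΔ : P (countEq Ω Δ 0) (countEq Ω 0 0) = 0) :
    P (countEq Ω (Δ + Δ) 1) (countEq Ω 0 0) = 0 := by
  have hne := hΩ.countEq_nonempty 0 0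
  have hne1 := hΩ.countEq_nonempty Δ 1
  have huniv : (Set.univ : Set Ω).Nonempty := hne.mono (Set.subset_univ _)
  have h0 : Q (countEq Ω Δ 0) (countEq Ω 0 0) = 0 :=
    (hPQ _ (mem_domainCP_countEq zero_le {0} 0)).symm.trans hΔ
  have hstart : Q (countEq Ω 0 0) Set.univ = 1 :=
    (hPQ _ (mem_domainCP_univ 0 {0})).symm.trans hP.start
  have hrest : Q (countEq Ω (Δ + Δ) 1) (countEq Ω Δ 1) = 0 := by
    refine (hPQ _ (mem_domainCP_countEq le_self_add {1} 1)).symm.trans ?_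
    exact (hP.homogeneous Δ Δ le_rfl).trans hΔ
  -- As `X_0 = 0` has probability one, it suffices to bound the unconditional probability of
  -- resting in the second half, where `hrest` applies directly.
  have hboth : Q (countEq Ω (Δ + Δ) 1 ∩ countEq Ω Δ 1) Set.univ = 0 := by
    rw [hQ.bayes _ _ _ huniv hne1 (by rwa [Set.inter_univ]), Set.inter_univ, hrest, zero_mul]
  have hcover : countEq Ω (Δ + Δ) 1 ⊆ countEq Ω Δ 0 ∪ countEq Ω (Δ + Δ) 1 ∩ countEq Ω Δ 1 := by
    intro ω hω
    have hle := hΩ.le ω (le_self_add : Δ ≤ Δ + Δ)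
    simp only [countEq, Set.mem_inter_iff, Set.mem_union, Set.mem_ofPred_eq] at hω ⊢
    omega
  have hdisj : countEq Ω Δ 0 ∩ (countEq Ω (Δ + Δ) 1 ∩ countEq Ω Δ 1) = ∅ := by
    refine Set.eq_empty_of_forall_notMem fun ω => ?_
    simp only [countEq, Set.mem_inter_iff, Set.mem_ofPred_eq]
    omega
  have hle := hQ.mono hne hcover
  rw [hQ.add _ _ _ hne hdisj, h0, zero_add] at hle
  refine (hPQ _ (mem_domainCP_countEq zero_le {1} 0)).trans (le_antisymm ?_ (hQ.nonneg _ _ hne))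
  exact (hle.trans (hQ.le_univ_of_eq_one hne hstart)).trans_eq hboth

theorem exists_prob_zero_ne_zero (hΩ : IsSampleSpace Ω) (hP : IsPoissonProcess P)
    (hQ : IsFullCondProb Q) (hPQ : ∀ p ∈ domainCP Ω, P p.1 p.2 = Q p.1 p.2) :
    ∃ t : ℝ≥0, 0 < t ∧ P (countEq Ω t 0) (countEq Ω 0 0) ≠ 0 := by
  by_contra! hzero
  have hsmall : ∀ᶠ Δ : ℝ≥0 in 𝓝[>] 0, Δ < 1 := nhdsWithin_le_nhds (Iio_mem_nhds one_pos)
  obtain ⟨Δ, hlt, hΔ1, hΔ⟩ := ((hP.tendsto_ge_two_div.eventually_lt_const one_pos).and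
    (hsmall.and self_mem_nhdsWithin)).exists
  have hΔ' : 0 < Δ := hΔ
  have hone := prob_one_add_self_eq_zero hΩ hP hQ hPQ (hzero (Δ / 2) (half_pos hΔ'))
  rw [add_halves] at hone
  have hsum := sum_eq_one hΩ hQ hPQ Δ
  rw [hzero Δ hΔ', hone, zero_add, zero_add] at hsum
  rw [hsum, div_lt_one (NNReal.coe_pos.mpr hΔ')] at hlt
  have : (Δ : ℝ) < 1 := by exact_mod_cast hΔ1
  linarith

theorem exists_tendsto_one_div (hΩ : IsSampleSpace Ω) (hP : IsPoissonProcess P) :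
    ∃ rate : ℝ≥0, Tendsto (fun Δ : ℝ≥0 => P (countEq Ω Δ 1) (countEq Ω 0 0) / (Δ : ℝ))
      (𝓝[>] 0) (𝓝 (rate : ℝ)) := by
  obtain ⟨Q, hQ, hPQ⟩ := hP.coherent
  have hne := hΩ.countEq_nonempty 0 0
  have h0 (t : ℝ≥0) : P (countEq Ω t 0) (countEq Ω 0 0) = Q (countEq Ω t 0) (countEq Ω 0 0) :=
    hPQ _ (mem_domainCP_countEq zero_le {0} 0)
  obtain ⟨t₀, ht₀, hne₀⟩ := exists_prob_zero_ne_zero hΩ hP hQ hPQ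
  obtain ⟨rate, hrate⟩ := exists_eq_exp_neg_mul (prob_zero_add hΩ hP hQ hPQ)
    (fun t => (hQ.nonneg _ _ hne).trans_eq (h0 t).symm)
    (fun t => (h0 t).trans_le (hQ.le_one hne)) ht₀ hne₀
  refine ⟨rate, ?_⟩
  have h := (tendsto_one_sub_exp_neg_mul_div rate).sub hP.tendsto_ge_two_div
  rw [sub_zero] at h
  refine h.congr fun Δ => ?_
  rw [← sub_div, ← hrate, ← sum_eq_one hΩ hQ hPQ Δ]
  ring

end IsPoissonProcess

end CountingProcess

theorem mainTheorem11 (Ω : Set (ℝ≥0 → ℕ)) (hΩ : CountingProcess.IsSampleSpace Ω)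
    (P : Set Ω → Set Ω → ℝ) (hP : CountingProcess.IsPoissonProcess P) :
    ∃ rate : ℝ≥0, ∀ (t : ℝ≥0) (u : Finset ℝ≥0) (xu : u → ℕ) (x : ℕ),
      CountingProcess.History t u xu x →
      Tendsto (fun Δ : ℝ≥0 =>
          P (CountingProcess.countEq Ω (t + Δ) (x + 1))
            (CountingProcess.tupleEq Ω u xu ∩ CountingProcess.countEq Ω t x) / (Δ : ℝ))
        (𝓝[>] 0) (𝓝 (rate : ℝ)) ∧
      (0 < t →
        Tendsto (fun Δ : ℝ≥0 =>
            P (CountingProcess.countEq Ω t (x + 1))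
              (CountingProcess.tupleEq Ω u xu ∩ CountingProcess.countEq Ω (t - Δ) x) / (Δ : ℝ))
          (𝓝[>] 0) (𝓝 (rate : ℝ))) := by
  obtain ⟨rate, hrate⟩ := hP.exists_tendsto_one_div hΩ
  refine ⟨rate, fun t u xu x h => ⟨?_, fun ht => ?_⟩⟩
  · exact hrate.congr fun Δ => by rw [hP.transition_eq Δ h]
  · -- For small `Δ`, no truncation occurs in `t - Δ`, and `t - Δ` still lies after `u`.
    have hle : ∀ᶠ Δ : ℝ≥0 in 𝓝[>] 0, Δ ≤ t := nhdsWithin_le_nhds (Iic_mem_nhds ht)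
    have hafter : ∀ᶠ Δ : ℝ≥0 in 𝓝[>] 0, ∀ s ∈ u, s < t - Δ := by
      refine nhdsWithin_le_nhds ((Filter.eventually_all_finset u).mpr fun s hs => ?_)
      filter_upwards [Iio_mem_nhds (tsub_pos_of_lt (h.1 s hs))] with Δ hΔ
      exact lt_tsub_comm.mp hΔ
    refine hrate.congr' ?_
    filter_upwards [hle, hafter] with Δ hΔ hu
    have := hP.transition_eq Δ (t := t - Δ) ⟨hu, h.2⟩
    rw [tsub_add_cancel_of_le hΔ] at this
    rw [this]
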